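/- Let $d\in\mathbb N$ and let $\{\lambda_\varepsilon\}_{\varepsilon>0}$ be a family of Borel probability measures on $\mathbb R^d$ such that $\lambda_\varepsilon(\{0\})=0$ for every $\varepsilon>0$ and $$\lim_{\varepsilon\downarrow 0}\lambda_\varepsilon\big(\{y\in\mathbb R^d: |y|>R\}\big)=0\qquad\text{for every } R>0 .$$ Let $\mu_\varepsilon$ be the probability measure on the unit sphere $\mathbb S^{d-1}$ given by $\mu_\varepsilon(S)=\lambda_\varepsilon(\{re: r>0,\ e\in S\})$ for Borel sets $S\subset\mathbb S^{d-1}$. Then there exist a sequence $\varepsilon_j>0$ converging to $0$ and a probability measure $\mu$ on $\mathbb S^{d-1}$ such that $\mu_{\varepsilon_j}\to\mu$ weakly and such that, for every $f\in \mathrm{BV}(\mathbb R^d)$, $$\lim_{j\to\infty}\int_{\mathbb R^d}\int_{\mathbb R^d}\frac{|f(x+y)-f(x)|}{|y|}\,\lambda_{\varepsilon_j}(\mathrm dy)\,\mathrm dx=\int_{\mathbb S^{d-1}}|Df\cdot\theta|(\mathbb R^d)\,\mu(\mathrm d\theta).$$ Here $\mathrm{BV}(\mathbb R^d)$ is the set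 of $f\in L^1(\mathbb R^d)$ with $\sup\{\int_{\mathbb R^d} f\,\mathrm{div}\,v\,\mathrm dx: v\in C_c^\infty(\mathbb R^d,\mathbb R^d),\ \|v\|_\infty\le 1\}<\infty$; for such $f$, the distributional gradient $Df$ is an $\mathbb R^d$-valued Borel measure of finite total variation, characterized by $\int f\,\nabla\varphi\,\mathrm dx=-\int\varphi\,\mathrm d(Df)$ for all $\varphi\in C_c^\infty(\mathbb R^d)$, and $|Df\cdot\theta|$ denotes the total variation measure of the signed measure $A\mapsto Df(A)\cdot\theta$. -/

import Mathlib

open MeasureTheory Filter Topology Set Metric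
open scoped ContDiff Gradient

noncomputable section

namespace NonlocalPerimeter

/-- Divergence of a vector field on `ℝ^d`: the sum of `∂ᵢ vᵢ`. -/
def divergence {d : ℕ} (v : EuclideanSpace ℝ (Fin d) → EuclideanSpace ℝ (Fin d))
    (x : EuclideanSpace ℝ (Fin d)) : ℝ :=
  ∑ i, (fderiv ℝ v x (EuclideanSpace.single i 1)) i

/-- The total variation `|Df|(ℝ^d)` in variational form: the supremum of `∫ f div v` over smooth
compactly supported vector fields `v` with `‖v‖_∞ ≤ 1`. (The supremum is nonnegative, since
`v = 0` is admissible, so passing to `[0, ∞]` by `ENNReal.ofReal` changes nothing.) -/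
def totalVariation {d : ℕ} (f : EuclideanSpace ℝ (Fin d) → ℝ) : ENNReal :=
  ⨆ (v : EuclideanSpace ℝ (Fin d) → EuclideanSpace ℝ (Fin d))
    (_ : ContDiff ℝ ∞ v ∧ HasCompactSupport v ∧ ∀ x, ‖v x‖ ≤ 1),
    ENNReal.ofReal (∫ x, f x * divergence v x)

/-- `f ∈ BV(ℝ^d)`: `f ∈ L¹(ℝ^d)` and `|Df|(ℝ^d) < ∞`. -/
def IsBV {d : ℕ} (f : EuclideanSpace ℝ (Fin d) → ℝ) : Prop :=
  Integrable f ∧ totalVariation f < ⊤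

/-- `D` is the distributional gradient `Df` of `f`: an `ℝ^d`-valued Borel measure of finite total
variation with `∫ f ∇φ dx = - ∫ φ dD` for all `φ ∈ C_c^∞(ℝ^d)`. -/
structure IsDistribGradient {d : ℕ} (f : EuclideanSpace ℝ (Fin d) → ℝ)
    (D : VectorMeasure (EuclideanSpace ℝ (Fin d)) (EuclideanSpace ℝ (Fin d))) : Prop where
  finite_variation : IsFiniteMeasure D.variation
  integral_smul_gradient : ∀ φ : EuclideanSpace ℝ (Fin d) → ℝ,
    ContDiff ℝ ∞ φ → HasCompactSupport φ → ∫ x, f x • ∇ φ x = - ∫ᵛ x, φ x ∂•D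

/-- The signed measure `D · θ : A ↦ ⟨θ, D(A)⟩`. -/
def dotMeasure {d : ℕ} (D : VectorMeasure (EuclideanSpace ℝ (Fin d)) (EuclideanSpace ℝ (Fin d)))
    (θ : EuclideanSpace ℝ (Fin d)) : SignedMeasure (EuclideanSpace ℝ (Fin d)) :=
  D.mapRange (innerSL ℝ θ : EuclideanSpace ℝ (Fin d) →+ ℝ) (innerSL ℝ θ).continuous

/-- The projection of a measure `ν` on `ℝ^d` to the unit sphere: restrict `ν` to `ℝ^d ∖ {0}` and
push it forward under `y ↦ y / |y|`. See `sphericalProjection_apply` for the description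
by cones. -/
def sphericalProjection {d : ℕ} (ν : Measure (EuclideanSpace ℝ (Fin d))) :
    Measure (sphere (0 : EuclideanSpace ℝ (Fin d)) 1) :=
  (ν.comap (Subtype.val : ({0}ᶜ : Set (EuclideanSpace ℝ (Fin d))) → _)).map
    (fun y => (homeomorphUnitSphereProd (EuclideanSpace ℝ (Fin d)) y).1)

/-- The mass of a set `S` of directions is the `ν`-mass of the cone `(0, ∞) S`. -/
theorem sphericalProjection_apply {d : ℕ} (ν : Measure (EuclideanSpace ℝ (Fin d)))
    {S : Set (sphere (0 : EuclideanSpace ℝ (Fin d)) 1)} (hS : MeasurableSet S) :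
    sphericalProjection ν S =
      ν {x | ∃ r : ℝ, 0 < r ∧ ∃ e ∈ S, x = r • (e : EuclideanSpace ℝ (Fin d))} := by
  have hm : Measurable (fun y : ({0}ᶜ : Set (EuclideanSpace ℝ (Fin d))) =>
      (homeomorphUnitSphereProd (EuclideanSpace ℝ (Fin d)) y).1) := by
    fun_prop
  rw [sphericalProjection, Measure.map_apply hm hS,
    (MeasurableEmbedding.subtype_coe (measurableSet_singleton _).compl).comap_apply]
  congr 1
  ext x
  constructor
  · rintro ⟨⟨y, hy⟩, hyS, rfl⟩
    have hy0 : ‖y‖ ≠ 0 := norm_ne_zero_iff.2 hy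
    refine ⟨‖y‖, norm_pos_iff.2 hy, _, hyS, ?_⟩
    simp [smul_smul, hy0]
  · rintro ⟨r, hr, e, he, rfl⟩
    have hn : ‖(e : EuclideanSpace ℝ (Fin d))‖ = 1 := by simp
    have hne : r • (e : EuclideanSpace ℝ (Fin d)) ∈
        ({0}ᶜ : Set (EuclideanSpace ℝ (Fin d))) := by
      have : (e : EuclideanSpace ℝ (Fin d)) ≠ 0 := by
        intro h; simp [h] at hn
      simp [hr.ne', this]
    refine ⟨⟨_, hne⟩, ?_, rfl⟩
    have : (homeomorphUnitSphereProd (EuclideanSpace ℝ (Fin d))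
        ⟨r • (e : EuclideanSpace ℝ (Fin d)), hne⟩).1 = e := by
      ext1
      simp [norm_smul, hn, abs_of_pos hr, smul_smul, hr.ne']
    rw [mem_preimage, this]
    exact he

end NonlocalPerimeter

end

/-! Put V(y) = |Df·y|(ℝ^d), which is positively homogeneous and Lipschitz in y. By Tonelli the
energy is the λ_ε-average of ‖f(·+y) − f‖₁/|y|, so it is compared with the average of V(y/|y|), i.e.
with ∫ V dμ_ε.

Above: ‖f(·+y) − f‖₁ ≤ V(y) for every y (`IsDistribGradient.integral_abs_sub_le`), by testing the
increment and integrating the weak derivative along the segment. Below: a test function that nearly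
attains V(θ₀) gives V(θ) ≤ ‖f(·+rθ) − f‖₁/r + η for θ near θ₀ and small r; compactness of the sphere
makes this uniform in θ (`IsDistribGradient.exists_directionalVariation_le`). The two averages
therefore differ by at most η + |Df|(ℝ^d) λ_ε(|y| > R), which concentration makes small. A weakly
convergent subsequence of μ_ε, chosen independently of f, finishes the proof because V is
continuous.

The existence of Df is proved as well: difference quotients along each axis are bounded in L¹, and
their positive and negative parts have vague limits, by Riesz–Markov. -/

noncomputable section

namespace NonlocalPerimeter

/-! ### Integration against vector and signed measures. -/

section VectorMeasureIntegral

variable {X F G : Type*} {mX : MeasurableSpace X} [NormedAddCommGroup F] [NormedSpace ℝ F]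
  [NormedAddCommGroup G] [NormedSpace ℝ G]

theorem variation_mapRange_le (D : VectorMeasure X F) (T : F →L[ℝ] G) :
    (D.mapRange (T : F →+ G) T.continuous).variation ≤ ‖T‖₊ • D.variation := by
  refine VectorMeasure.variation_le_of_forall_enorm_le fun s _ => ?_
  simp only [Measure.smul_apply, Measure.nnreal_smul_coe_apply]
  refine (T.le_opENorm _).trans ?_
  rw [enorm_eq_nnnorm]
  gcongr
  exact D.enorm_measure_le_variation s

instance isFiniteMeasure_variation_mapRange (D : VectorMeasure X F) [IsFiniteMeasure D.variation]
    (T : F →L[ℝ] G) : IsFiniteMeasure (D.mapRange (T : F →+ G) T.continuous).variation :=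
  isFiniteMeasure_of_le _ (variation_mapRange_le D T)

/-- A continuous linear map commutes with integration against a vector measure. -/
theorem integral_mapRange [CompleteSpace F] [CompleteSpace G] (D : VectorMeasure X F)
    [IsFiniteMeasure D.variation] (T : F →L[ℝ] G) {φ : X → ℝ} (hφ : Integrable φ D.variation) :
    ∫ᵛ x, φ x ∂•(D.mapRange (T : F →+ G) T.continuous) = T (∫ᵛ x, φ x ∂•D) := by
  set D' := D.mapRange (T : F →+ G) T.continuous with hD'
  have hle := variation_mapRange_le D T
  have hac : D'.variation ≪ D.variation :=
    (Measure.absolutelyContinuous_of_le hle).trans (Measure.smul_absolutelyContinuous)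
  have hint : ∀ {ψ : X → ℝ}, Integrable ψ D.variation → Integrable ψ D'.variation := fun h =>
    (h.smul_measure_nnreal (c := ‖T‖₊)).mono_measure hle
  refine Integrable.induction
    (fun φ => ∫ᵛ x, φ x ∂•D' = T (∫ᵛ x, φ x ∂•D)) ?_ ?_ ?_ ?_ hφ
  · intro c s hs hlt
    simp only [VectorMeasure.integral_indicator hs, VectorMeasure.setIntegral_const]
    simp only [ContinuousLinearMap.lsmul_apply, map_smul]
    rfl
  · intro f g hd hf hg ihf ihg
    simp only [Pi.add_apply]
    rw [VectorMeasure.integral_fun_add (hint hf) (hint hg), VectorMeasure.integral_fun_add hf hg,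
      ihf, ihg, map_add]
  · have h1 : Continuous fun f : X →₁[D.variation] ℝ => T (∫ᵛ x, f x ∂•D) :=
      T.continuous.comp VectorMeasure.continuous_integral
    refine isClosed_eq ?_ h1
    -- L¹ convergence for `D.variation` implies it for `D'.variation`, since the latter is at most
    -- ‖T‖ times the former.
    rw [continuous_iff_continuousAt]
    intro f
    refine VectorMeasure.tendsto_integral_of_L1 (μ := D') _
      (hint (L1.integrable_coeFn f)).aestronglyMeasurable
      (Eventually.of_forall fun g => hint (L1.integrable_coeFn g)) ?_
    have h2 : Tendsto (fun g : X →₁[D.variation] ℝ => (‖T‖₊ : ENNReal) * edist g f) (𝓝 f) (𝓝 0) := by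
      have := ENNReal.Tendsto.const_mul (a := (‖T‖₊ : ENNReal))
        (tendsto_iff_edist_tendsto_0.1 (tendsto_id (x := 𝓝 f))) (Or.inr ENNReal.coe_ne_top)
      simpa using this
    refine tendsto_of_tendsto_of_tendsto_of_le_of_le tendsto_const_nhds h2 (fun _ => zero_le) ?_
    intro g
    calc _ ≤ ∫⁻ x, ‖g x - f x‖ₑ ∂(‖T‖₊ • D.variation) := lintegral_mono' hle le_rfl
      _ = _ := by
        simp only []
        rw [lintegral_smul_measure, Lp.edist_def, eLpNorm_one_eq_lintegral_enorm]
        rfl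
  · intro f g hfg hf ih
    rw [← VectorMeasure.integral_congr_ae (μ := D') (hac.ae_eq hfg),
      ← VectorMeasure.integral_congr_ae hfg, ih]

theorem integral_toSignedMeasure' (ν : Measure X) [IsFiniteMeasure ν] (φ : X → ℝ) :
    ∫ᵛ x, φ x ∂•ν.toSignedMeasure = ∫ x, φ x ∂ν := by
  rw [← VectorMeasure.integral_toSignedMeasure]
  congr 1
  ext
  simp

theorem integral_signedMeasure (s : SignedMeasure X) {φ : X → ℝ}
    (hφ : Integrable φ s.toJordanDecomposition.posPart)
    (hφ' : Integrable φ s.toJordanDecomposition.negPart) :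
    ∫ᵛ x, φ x ∂•s = ∫ x, φ x ∂s.toJordanDecomposition.posPart
      - ∫ x, φ x ∂s.toJordanDecomposition.negPart := by
  conv_lhs => rw [← s.toSignedMeasure_toJordanDecomposition, JordanDecomposition.toSignedMeasure]
  rw [VectorMeasure.integral_sub_vectorMeasure, integral_toSignedMeasure',
    integral_toSignedMeasure']
  · simpa [VectorMeasure.Integrable] using hφ
  · simpa [VectorMeasure.Integrable] using hφ'

end VectorMeasureIntegral

/-! ### Duality of total variation and L¹ norm with smooth test functions. -/

section Approximation

variable {E : Type*} [NormedAddCommGroup E] [NormedSpace ℝ E]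
  [MeasurableSpace E] [BorelSpace E]

/-- The test functions for total variations: smooth, compactly supported, bounded by `1`. -/
structure IsTest (φ : E → ℝ) : Prop where
  contDiff : ContDiff ℝ ∞ φ
  hasCompactSupport : HasCompactSupport φ
  abs_le : ∀ x, |φ x| ≤ 1

theorem IsTest.integrable {φ : E → ℝ} (hφ : IsTest φ) (ν : Measure E)
    [IsFiniteMeasureOnCompacts ν] : Integrable φ ν :=
  hφ.contDiff.continuous.integrable_of_hasCompactSupport hφ.hasCompactSupport

variable [FiniteDimensional ℝ E]

/-- Measurable functions bounded by `1` are `L¹`-limits of test functions. -/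
theorem exists_isTest_integral_le (ν : Measure E) [IsFiniteMeasure ν] {h : E → ℝ}
    (hm : Measurable h) (hb : ∀ x, |h x| ≤ 1) {η : ℝ} (hη : 0 < η) :
    ∃ φ, IsTest φ ∧ ∫ x, |h x - φ x| ∂ν ≤ η := by
  have hint : Integrable h ν := Integrable.of_bound hm.aestronglyMeasurable 1
    (Eventually.of_forall hb)
  obtain ⟨g, hgc, hgη, hgcont, hgL⟩ := (memLp_one_iff_integrable.2 hint)
    |>.exists_hasCompactSupport_eLpNorm_sub_le ENNReal.one_ne_top
      (ε := ENNReal.ofReal (η / 2)) (by simpa using hη)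
  -- Truncation to [-1, 1] keeps the support compact and, as h takes values there, does not increase
  -- the distance to h.
  set k : E → ℝ := fun x => max (-1) (min 1 (g x)) with hk
  have hkcont : Continuous k := by fun_prop
  have hkb : ∀ x, |k x| ≤ 1 := fun x => abs_le.2 ⟨le_max_left _ _, max_le (by norm_num) (min_le_left _ _)⟩
  have hks : HasCompactSupport k := hgc.comp_left (g := fun t => max (-1) (min 1 t)) (by norm_num)
  have hkint : Integrable k ν := hkcont.integrable_of_hasCompactSupport hks
  have hgint : Integrable g ν := memLp_one_iff_integrable.1 hgL
  have hhk : ∫ x, |h x - k x| ∂ν ≤ η / 2 := by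
    calc ∫ x, |h x - k x| ∂ν ≤ ∫ x, |h x - g x| ∂ν := by
          refine integral_mono (hint.sub hkint).abs (hint.sub hgint).abs fun x => ?_
          have := abs_le.1 (hb x)
          simp only [hk]
          rcases max_cases (-1) (min 1 (g x)) with h1 | h1 <;>
          rcases min_cases 1 (g x) with h2 | h2 <;>
          rw [h1.1] <;> try rw [h2.1]
          all_goals
            rcases abs_cases (h x - g x) with h3 | h3 <;> rw [h3.1] <;> apply abs_le.2 <;>
            constructor <;> linarith
      _ = (eLpNorm (h - g) 1 ν).toReal := by
          rw [eLpNorm_one_eq_lintegral_enorm,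
            integral_eq_lintegral_of_nonneg_ae (f := fun x => |h x - g x|)
            (Eventually.of_forall fun _ => abs_nonneg _)
            (hint.sub hgint).aestronglyMeasurable.norm]
          simp [Real.enorm_eq_ofReal_abs]
      _ ≤ η / 2 := ENNReal.toReal_le_of_le_ofReal (by positivity) hgη
  set N : ℝ := ν.real univ with hN
  have hN0 : 0 ≤ N := measureReal_nonneg
  obtain ⟨δ, hδ, hδN⟩ : ∃ δ : ℝ, 0 < δ ∧ 2 * δ * N ≤ η / 2 := by
    refine ⟨η / (4 * (N + 1)), by positivity, ?_⟩
    rw [mul_div_assoc', div_mul_eq_mul_div, div_le_div_iff₀ (by positivity) (by positivity)]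
    nlinarith
  -- The smooth u may exceed 1 by δ. Dividing by 1 + δ restores the bound and moves it at most 2δ
  -- away from k, which the choice of δ pays for.
  obtain ⟨u, hu, hud, hus⟩ := hkcont.exists_contDiff_approx ⊤ (continuous_const (y := δ))
    (fun _ => hδ)
  have hud' : ∀ x, |u x - k x| ≤ δ := fun x => (hud x).le
  refine ⟨fun x => (1 + δ)⁻¹ * u x, ⟨contDiff_const.mul hu,
    (hks.mono hus).mul_left, fun x => ?_⟩, ?_⟩
  · rw [abs_mul, abs_inv, abs_of_pos (by positivity : 0 < 1 + δ), inv_mul_le_iff₀ (by positivity)]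
    have := abs_le.1 (hud' x); have := abs_le.1 (hkb x)
    exact abs_le.2 ⟨by linarith, by linarith⟩
  · have hpt : ∀ x, |h x - (1 + δ)⁻¹ * u x| ≤ |h x - k x| + 2 * δ := by
      intro x
      have h1 : |k x - (1 + δ)⁻¹ * u x| ≤ 2 * δ := by
        have h2 : k x - (1 + δ)⁻¹ * u x = (1 + δ)⁻¹ * ((k x - u x) + δ * k x) := by
          field_simp; ring
        rw [h2, abs_mul, abs_inv, abs_of_pos (by positivity : 0 < 1 + δ),
          inv_mul_le_iff₀ (by positivity)]
        have := abs_le.1 (hud' x); have := abs_le.1 (hkb x)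
        exact abs_le.2 ⟨by nlinarith, by nlinarith⟩
      calc _ = |(h x - k x) + (k x - (1 + δ)⁻¹ * u x)| := by ring_nf
        _ ≤ _ := (abs_add_le _ _).trans (by linarith)
    have huint : Integrable (fun x => (1 + δ)⁻¹ * u x) ν :=
      (hu.continuous.integrable_of_hasCompactSupport (hks.mono hus)).const_mul _
    calc _ ≤ ∫ x, (|h x - k x| + 2 * δ) ∂ν :=
          integral_mono (hint.sub huint).abs ((hint.sub hkint).abs.add (integrable_const _)) hpt
      _ = ∫ x, |h x - k x| ∂ν + 2 * δ * N := by
          rw [integral_add (f := fun x => |h x - k x|) (hint.sub hkint).abs (integrable_const _)]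
          simp [hN, mul_comm]
      _ ≤ η := by linarith

/-- The total variation of a signed measure is computed by test functions. -/
theorem variation_univ_le_of_forall_isTest (s : SignedMeasure E) {M : ℝ}
    (hM : ∀ φ : E → ℝ, IsTest φ → ∫ᵛ x, φ x ∂•s ≤ M) :
    s.variation univ ≤ ENNReal.ofReal M := by
  rw [← SignedMeasure.totalVariation_eq_variation]
  obtain ⟨A, hA, hpos, hneg, hp, hn⟩ := s.toJordanDecomposition_spec
  set P := s.toJordanDecomposition.posPart
  set N := s.toJordanDecomposition.negPart
  have hPA : P Aᶜ = 0 := by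
    rw [hp, SignedMeasure.toMeasureOfZeroLE_apply _ _ _ hA.compl]; simp
  have hNA : N A = 0 := by
    rw [hn, SignedMeasure.toMeasureOfLEZero_apply _ _ _ hA]; simp
  -- The sign of the Hahn decomposition: its integral against s is the full variation, and test
  -- functions approximate it in L¹(P + N).
  set h : E → ℝ := A.indicator 1 - Aᶜ.indicator 1 with hh
  have hm : Measurable h := (measurable_one.indicator hA).sub (measurable_one.indicator hA.compl)
  have hb : ∀ x, |h x| ≤ 1 := by
    intro x; by_cases hx : x ∈ A <;> simp [hh, hx]
  have hint : ∀ (ν : Measure E) [IsFiniteMeasure ν], Integrable h ν := fun ν _ =>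
    Integrable.of_bound hm.aestronglyMeasurable 1 (Eventually.of_forall hb)
  have hPh : ∫ x, h x ∂P = P.real univ := by
    have : h =ᵐ[P] fun _ => 1 := by
      filter_upwards [compl_mem_ae_iff.2 hPA] with x hx
      simp only [compl_compl] at hx
      simp [hh, hx]
    rw [integral_congr_ae this]; simp
  have hNh : ∫ x, h x ∂N = - N.real univ := by
    have : h =ᵐ[N] fun _ => -1 := by
      filter_upwards [compl_mem_ae_iff.2 hNA] with x hx
      simp only [mem_compl_iff] at hx
      simp [hh, hx]
    rw [integral_congr_ae this]; simp
  have hTV : s.totalVariation univ = ENNReal.ofReal (P.real univ + N.real univ) := by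
    rw [SignedMeasure.totalVariation, ENNReal.ofReal_add measureReal_nonneg measureReal_nonneg]
    simp [P, N]
  rw [hTV]
  refine ENNReal.ofReal_le_ofReal (le_of_forall_pos_le_add fun η hη => ?_)
  obtain ⟨φ, hφ, hφη⟩ := exists_isTest_integral_le (P + N) hm hb hη
  have hs := hM φ hφ
  rw [integral_signedMeasure s (hφ.integrable _) (hφ.integrable _)] at hs
  have hi : ∀ (ν : Measure E) [IsFiniteMeasure ν], Integrable (fun x => |h x - φ x|) ν :=
    fun ν _ => ((hint ν).sub (hφ.integrable ν)).abs
  rw [integral_add_measure (hi P) (hi N)] at hφη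
  have e1 : ∫ x, h x ∂P - ∫ x, φ x ∂P ≤ ∫ x, |h x - φ x| ∂P := by
    rw [← integral_sub (hint P) (hφ.integrable P)]
    exact integral_mono ((hint P).sub (hφ.integrable P)) (hi P) fun x => le_abs_self _
  have e2 : ∫ x, φ x ∂N - ∫ x, h x ∂N ≤ ∫ x, |h x - φ x| ∂N := by
    rw [← integral_sub (hφ.integrable N) (hint N)]
    exact integral_mono ((hφ.integrable N).sub (hint N)) (hi N)
      fun x => (le_abs_self _).trans_eq (abs_sub_comm _ _)
  linarith

/-- The `L¹` norm is computed by test functions. -/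
theorem integral_abs_le_of_forall_isTest {ν : Measure E} {g : E → ℝ}
    (hg : Integrable g ν) {M : ℝ} (hM : ∀ φ : E → ℝ, IsTest φ → ∫ x, g x * φ x ∂ν ≤ M) :
    ∫ x, |g x| ∂ν ≤ M := by
  wlog hgm : StronglyMeasurable g generalizing g
  · have hae := hg.1.ae_eq_mk
    have := this (g := hg.1.mk g) (hg.congr hae) (fun φ hφ => by
      rw [integral_congr_ae (g := fun x => g x * φ x)]
      · exact hM φ hφ
      · filter_upwards [hae] with x hx; rw [hx]) hg.1.stronglyMeasurable_mk
    rwa [integral_congr_ae (g := fun x => |g x|)] at this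
    filter_upwards [hae] with x hx; rw [hx]
  have hgm' := hgm.measurable
  -- Approximating sign g in L¹ of the finite measure |g|ν puts the weight |g| into the error, and ν
  -- itself may be infinite.
  set ρ : Measure E := ν.withDensity (fun x => ‖g x‖ₑ) with hρ
  have : IsFiniteMeasure ρ := isFiniteMeasure_withDensity hg.2.ne
  set h : E → ℝ := fun x => SignType.sign (g x) with hh
  have hm : Measurable h := by
    have : h = fun x => ({z | 0 < g z}.indicator 1 x : ℝ) - {z | g z < 0}.indicator 1 x := by
      ext x
      rcases lt_trichotomy (g x) 0 with h1 | h1 | h1 <;> simp [hh, h1, h1.not_gt]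
    rw [this]
    exact (measurable_one.indicator (measurableSet_lt measurable_const hgm')).sub
      (measurable_one.indicator (measurableSet_lt hgm' measurable_const))
  have hb : ∀ x, |h x| ≤ 1 := by
    intro x
    rcases lt_trichotomy (g x) 0 with h1 | h1 | h1 <;> simp [hh, h1]
  refine le_of_forall_pos_le_add fun η hη => ?_
  obtain ⟨φ, hφ, hφη⟩ := exists_isTest_integral_le ρ hm hb hη
  have hφm : Measurable φ := hφ.contDiff.continuous.measurable
  rw [hρ, integral_withDensity_eq_integral_toReal_smul hgm'.enorm
    (Eventually.of_forall fun x => enorm_lt_top)] at hφη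
  simp only [toReal_enorm, Real.norm_eq_abs, smul_eq_mul] at hφη
  have i1 : Integrable (fun x => g x * φ x) ν :=
    hg.mul_bdd (c := 1) hφm.aestronglyMeasurable (Eventually.of_forall hφ.abs_le)
  have i2 : Integrable (fun x => |g x| * |h x - φ x|) ν := by
    refine hg.abs.mul_bdd (c := 2) (hm.sub hφm).abs.aestronglyMeasurable
      (Eventually.of_forall fun x => ?_)
    rw [Real.norm_eq_abs, abs_abs]
    exact (abs_sub _ _).trans (by linarith [hb x, hφ.abs_le x])
  calc ∫ x, |g x| ∂ν ≤ ∫ x, (g x * φ x + |g x| * |h x - φ x|) ∂ν := by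
        refine integral_mono hg.abs (i1.add i2) fun x => ?_
        have : |g x| = g x * h x := (self_mul_sign (g x)).symm
        have h2 : g x * h x - g x * φ x ≤ |g x| * |h x - φ x| := by
          rw [← abs_mul, ← mul_sub]; exact le_abs_self _
        show |g x| ≤ g x * φ x + |g x| * |h x - φ x|
        linarith
    _ = _ := integral_add i1 i2
    _ ≤ M + η := add_le_add (hM φ hφ) hφη

end Approximation

/-! ### Increments of f against test functions. -/

section DifferenceQuotients

variable {E : Type*} [NormedAddCommGroup E] [NormedSpace ℝ E]

theorem IsTest.neg {φ : E → ℝ} (hφ : IsTest φ) : IsTest (fun x => -φ x) :=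
  ⟨hφ.contDiff.neg, hφ.hasCompactSupport.neg, fun x => by simpa using hφ.abs_le x⟩

theorem IsTest.comp_sub {φ : E → ℝ} (hφ : IsTest φ) (y : E) : IsTest (fun x => φ (x - y)) :=
  ⟨hφ.contDiff.comp (contDiff_id.sub contDiff_const),
    hφ.hasCompactSupport.comp_homeomorph (Homeomorph.subRight y), fun _ => hφ.abs_le _⟩

theorem IsTest.differentiable {φ : E → ℝ} (hφ : IsTest φ) : Differentiable ℝ φ :=
  hφ.contDiff.differentiable (by simp)

theorem IsTest.continuous_fderiv {φ : E → ℝ} (hφ : IsTest φ) : Continuous (fderiv ℝ φ) :=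
  hφ.contDiff.continuous_fderiv (by simp)

theorem IsTest.exists_norm_fderiv_le {φ : E → ℝ} (hφ : IsTest φ) :
    ∃ C, ∀ x, ‖fderiv ℝ φ x‖ ≤ C :=
  (hφ.hasCompactSupport.fderiv ℝ).exists_bound_of_continuous hφ.continuous_fderiv

theorem IsTest.exists_norm_fderiv_sub_le {φ : E → ℝ} (hφ : IsTest φ) :
    ∃ C : ℝ, 0 ≤ C ∧ ∀ x y, ‖fderiv ℝ φ x - fderiv ℝ φ y‖ ≤ C * ‖x - y‖ := by
  obtain ⟨C, hC⟩ := ContDiff.lipschitzWith_of_hasCompactSupport (n := ∞) (𝕂 := ℝ)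
    (hφ.hasCompactSupport.fderiv ℝ) (hφ.contDiff.fderiv_right (by simp)) (by simp)
  exact ⟨C, C.2, fun x y => by simpa [dist_eq_norm] using hC.dist_le_mul x y⟩

theorem IsTest.sub_eq_intervalIntegral {φ : E → ℝ} (hφ : IsTest φ) (x y : E) :
    φ (x - y) - φ x = ∫ t in (0 : ℝ)..1, -fderiv ℝ φ (x - t • y) y := by
  have hd : ∀ t ∈ uIcc (0 : ℝ) 1,
      HasDerivAt (fun t : ℝ => φ (x - t • y)) (-fderiv ℝ φ (x - t • y) y) t := by
    intro t _
    have h1 : HasDerivAt (fun t : ℝ => x - t • y) (-y) t := by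
      simpa using ((hasDerivAt_id t).smul_const y).const_sub x
    have := (hφ.differentiable (x - t • y)).hasFDerivAt.comp_hasDerivAt t h1
    rw [map_neg] at this
    exact this
  have hc : Continuous fun t : ℝ => -fderiv ℝ φ (x - t • y) y :=
    ((hφ.continuous_fderiv.comp (by fun_prop)).clm_apply continuous_const).neg
  rw [intervalIntegral.integral_eq_sub_of_hasDerivAt hd (hc.intervalIntegrable _ _)]
  simp

/-- First-order Taylor expansion, from the integral along the segment and the Lipschitz continuity
of the derivative. -/
theorem IsTest.exists_abs_sub_add_fderiv_le {φ : E → ℝ} (hφ : IsTest φ) :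
    ∃ C : ℝ, 0 ≤ C ∧ ∀ x y, |φ (x - y) - φ x + fderiv ℝ φ x y| ≤ C * ‖y‖ ^ 2 := by
  obtain ⟨C, hC0, hC⟩ := hφ.exists_norm_fderiv_sub_le
  refine ⟨C, hC0, fun x y => ?_⟩
  have hc : Continuous fun t : ℝ => -fderiv ℝ φ (x - t • y) y :=
    ((hφ.continuous_fderiv.comp (by fun_prop)).clm_apply continuous_const).neg
  have h1 : φ (x - y) - φ x + fderiv ℝ φ x y
      = ∫ t in (0 : ℝ)..1, (-fderiv ℝ φ (x - t • y) y + fderiv ℝ φ x y) := by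
    rw [hφ.sub_eq_intervalIntegral, intervalIntegral.integral_add (hc.intervalIntegrable _ _)
      (continuous_const.intervalIntegrable _ _)]
    simp
  rw [h1, ← Real.norm_eq_abs]
  refine (intervalIntegral.norm_integral_le_of_norm_le_const (C := C * ‖y‖ ^ 2) ?_).trans
    (by simp)
  intro t ht
  rw [uIoc_of_le zero_le_one] at ht
  have h2 : -fderiv ℝ φ (x - t • y) y + fderiv ℝ φ x y
      = (fderiv ℝ φ x - fderiv ℝ φ (x - t • y)) y := by
    simp; ring
  rw [h2]
  calc _ ≤ ‖fderiv ℝ φ x - fderiv ℝ φ (x - t • y)‖ * ‖y‖ := ContinuousLinearMap.le_opNorm _ _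
    _ ≤ (C * ‖x - (x - t • y)‖) * ‖y‖ := by gcongr; exact hC _ _
    _ = C * (t * ‖y‖) * ‖y‖ := by
      rw [sub_sub_cancel, norm_smul, Real.norm_of_nonneg ht.1.le]
    _ ≤ C * (1 * ‖y‖) * ‖y‖ := by gcongr; exact ht.2
    _ = _ := by ring

variable [MeasurableSpace E] [BorelSpace E] {ν : Measure E} {f : E → ℝ}

theorem integrable_mul_fderiv (hf : Integrable f ν) {φ : E → ℝ} (hφ : IsTest φ) (y : E) :
    Integrable (fun x => f x * fderiv ℝ φ x y) ν := by
  obtain ⟨C, hC⟩ := hφ.exists_norm_fderiv_le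
  exact hf.mul_bdd (c := C * ‖y‖)
    (hφ.continuous_fderiv.clm_apply continuous_const).aestronglyMeasurable
    (Eventually.of_forall fun x => (ContinuousLinearMap.le_opNorm _ _).trans
      (by gcongr; exact hC x))

variable [ν.IsAddHaarMeasure]

/-- Translation invariance moves the increment from f onto the smooth φ. -/
theorem integral_sub_mul (hf : Integrable f ν) {φ : E → ℝ} (hφ : IsTest φ) (y : E) :
    ∫ x, (f (x + y) - f x) * φ x ∂ν = ∫ x, f x * (φ (x - y) - φ x) ∂ν := by
  have hb : ∀ {ψ : E → ℝ}, IsTest ψ → ∀ {g : E → ℝ}, Integrable g ν →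
      Integrable (fun x => g x * ψ x) ν := fun hψ _ hg =>
    hg.mul_bdd (c := 1) hψ.contDiff.continuous.aestronglyMeasurable
      (Eventually.of_forall hψ.abs_le)
  simp only [sub_mul, mul_sub]
  rw [integral_sub (hb hφ (hf.comp_add_right y)) (hb hφ hf),
    integral_sub (hb (hφ.comp_sub y) hf) (hb hφ hf),
    ← integral_sub_right_eq_self (fun x => f (x + y) * φ x) y]
  simp

/-- Difference quotients converge weakly to the derivative, with an error uniform in the direction.
Both the construction of Df and the lower bound rest on this. -/
theorem exists_abs_integral_sub_mul_add_le (hf : Integrable f ν) {φ : E → ℝ} (hφ : IsTest φ) :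
    ∃ C : ℝ, 0 ≤ C ∧ ∀ y, |∫ x, (f (x + y) - f x) * φ x ∂ν + ∫ x, f x * fderiv ℝ φ x y ∂ν|
      ≤ C * ‖y‖ ^ 2 := by
  obtain ⟨C, hC0, hC⟩ := hφ.exists_abs_sub_add_fderiv_le
  refine ⟨C * ∫ x, |f x| ∂ν, mul_nonneg hC0 (integral_nonneg fun _ => abs_nonneg _), fun y => ?_⟩
  have hi : Integrable (fun x => f x * (φ (x - y) - φ x)) ν :=
    hf.mul_bdd (c := 2) ((hφ.comp_sub y).contDiff.continuous.sub
      hφ.contDiff.continuous).aestronglyMeasurable (Eventually.of_forall fun x =>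
        (abs_sub _ _).trans (by linarith [hφ.abs_le x, hφ.abs_le (x - y)]))
  rw [integral_sub_mul hf hφ, ← integral_add hi (integrable_mul_fderiv hf hφ y)]
  calc _ ≤ ∫ x, (C * ‖y‖ ^ 2) * |f x| ∂ν := by
        rw [← Real.norm_eq_abs]
        refine norm_integral_le_of_norm_le (hf.abs.const_mul _) (Eventually.of_forall fun x => ?_)
        rw [← mul_add, Real.norm_eq_abs, abs_mul, mul_comm]
        gcongr
        exact hC x y
    _ = _ := by rw [integral_const_mul]; ring

variable [FiniteDimensional ℝ E]

theorem integral_sub_mul_eq_intervalIntegral (hf : Integrable f ν) {φ : E → ℝ} (hφ : IsTest φ)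
    (y : E) : ∫ x, (f (x + y) - f x) * φ x ∂ν =
      ∫ t in (0 : ℝ)..1, -∫ x, f x * fderiv ℝ φ (x - t • y) y ∂ν := by
  rw [integral_sub_mul hf hφ]
  simp_rw [hφ.sub_eq_intervalIntegral, intervalIntegral.integral_of_le zero_le_one,
    ← integral_const_mul, ← integral_neg]
  rw [integral_integral_swap]
  · simp
  · obtain ⟨C, hC⟩ := hφ.exists_norm_fderiv_le
    have hc : Continuous fun p : E × ℝ => -fderiv ℝ φ (p.1 - p.2 • y) y :=
      ((hφ.continuous_fderiv.comp (by fun_prop)).clm_apply continuous_const).neg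
    exact (hf.comp_fst (volume.restrict (Ioc (0 : ℝ) 1))).mul_bdd (c := C * ‖y‖)
      hc.aestronglyMeasurable (Eventually.of_forall fun p => by
        rw [norm_neg]
        exact (ContinuousLinearMap.le_opNorm _ _).trans (by gcongr; exact hC _))

/-- A bound on the weak derivative in direction `y` bounds the `L¹` norm of the increments. -/
theorem integral_abs_sub_le (hf : Integrable f ν) (y : E) {M : ℝ}
    (hM : ∀ φ : E → ℝ, IsTest φ → -∫ x, f x * fderiv ℝ φ x y ∂ν ≤ M) :
    ∫ x, |f (x + y) - f x| ∂ν ≤ M := by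
  refine integral_abs_le_of_forall_isTest ((hf.comp_add_right y).sub hf) fun φ hφ => ?_
  simp only [Pi.sub_apply]
  rw [integral_sub_mul_eq_intervalIntegral hf hφ]
  refine (le_abs_self _).trans ?_
  rw [← Real.norm_eq_abs]
  refine (intervalIntegral.norm_integral_le_of_norm_le_const (C := M) ?_).trans (by simp)
  intro t _
  -- Translates of test functions are test functions, so the hypothesis bounds the integrand at each
  -- t; using −ψ too bounds its absolute value.
  have hψ := hφ.comp_sub (t • y)
  have h1 := hM _ hψ
  have h2 := hM _ hψ.neg
  simp only [fderiv_fun_neg, neg_apply, mul_neg, integral_neg,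
    fderiv_comp_sub] at h1 h2
  rw [Real.norm_eq_abs]
  exact abs_le.2 ⟨by linarith, h1⟩

end DifferenceQuotients

/-! ### Vague compactness of measures of bounded mass. -/

section VagueCompactness

open CompactlySupported

variable {X ι : Type*} [TopologicalSpace X] [T2Space X] [LocallyCompactSpace X]
  [MeasurableSpace X] [BorelSpace X]

/-- Measures of bounded mass have vague limits along every ultrafilter. -/
theorem exists_tendsto_integral_ultrafilter (U : Ultrafilter ι) (ρ : ι → Measure X) (M : NNReal)
    (hρ : ∀ t, ρ t univ ≤ M) :
    ∃ ν : Measure X, IsFiniteMeasure ν ∧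
      ∀ φ : C_c(X, ℝ), Tendsto (fun t => ∫ x, φ x ∂ρ t) U (𝓝 (∫ x, φ x ∂ν)) := by
  have hfin : ∀ t, IsFiniteMeasure (ρ t) := fun t => ⟨(hρ t).trans_lt ENNReal.coe_lt_top⟩
  have hreal : ∀ t, (ρ t).real univ ≤ M := fun t =>
    ENNReal.toReal_le_of_le_ofReal M.2 (by simpa using hρ t)
  have hint : ∀ (φ : C_c(X, ℝ)) t, Integrable φ (ρ t) := fun φ t =>
    φ.continuous.integrable_of_hasCompactSupport φ.hasCompactSupport
  have hbound : ∀ φ : C_c(X, ℝ), ∀ C : ℝ, 0 ≤ C → (∀ x, ‖φ x‖ ≤ C) →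
      ∀ t, ‖∫ x, φ x ∂ρ t‖ ≤ C * M := fun φ C hC0 hC t =>
    (norm_integral_le_of_norm_le_const (Eventually.of_forall hC)).trans (by gcongr; exact hreal t)
  have hlim : ∀ φ : C_c(X, ℝ), ∃ l : ℝ, Tendsto (fun t => ∫ x, φ x ∂ρ t) U (𝓝 l) := by
    intro φ
    obtain ⟨C, hC⟩ := φ.hasCompactSupport.exists_bound_of_continuous φ.continuous
    have hC' : ∀ x, ‖φ x‖ ≤ max C 0 := fun x => (hC x).trans (le_max_left _ _)
    obtain ⟨l, -, hl⟩ := (isCompact_closedBall (0 : ℝ) (max C 0 * M)).ultrafilter_le_nhds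
      (U.map fun t => ∫ x, φ x ∂ρ t) (by
        rw [le_principal_iff]
        exact Filter.Eventually.of_forall (f := (U : Filter ι)) fun t => by
          simpa using hbound φ _ (le_max_right _ _) hC' t)
    exact ⟨l, hl⟩
  choose L hL using hlim
  -- Limits along an ultrafilter exist for all φ at once and inherit linearity and positivity, so
  -- Riesz–Markov applies.
  let Λ : C_c(X, ℝ) →ₚ[ℝ] ℝ := PositiveLinearMap.mk₀
    { toFun := L
      map_add' := fun φ ψ => tendsto_nhds_unique (hL (φ + ψ)) (by
        refine ((hL φ).add (hL ψ)).congr fun t => ?_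
        rw [← integral_add (hint φ t) (hint ψ t)]
        rfl)
      map_smul' := fun c φ => tendsto_nhds_unique (hL (c • φ)) (by
        refine ((hL φ).const_mul c).congr fun t => ?_
        rw [← integral_const_mul]
        rfl) }
    (fun φ hφ => ge_of_tendsto (hL φ) (Eventually.of_forall fun t =>
      integral_nonneg fun x => hφ x))
  refine ⟨RealRMK.rieszMeasure Λ, ⟨lt_of_le_of_lt ?_ (ENNReal.coe_lt_top (r := M))⟩, fun φ => ?_⟩
  -- The mass bound passes to the limit on each compact K through a cutoff that is 1 on K.
  · rw [isOpen_univ.measure_eq_iSup_isCompact]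
    refine iSup₂_le fun K _ => iSup_le fun hK => ?_
    obtain ⟨g, hg1, -, hgc, hg01⟩ := exists_continuous_one_zero_of_isCompact hK
      isClosed_empty (disjoint_empty K)
    let φ : C_c(X, ℝ) := ⟨g, hgc⟩
    refine (RealRMK.rieszMeasure_le_of_eq_one Λ (f := φ) (fun x => (hg01 x).1) hK hg1).trans ?_
    rw [← ENNReal.ofReal_coe_nnreal]
    refine ENNReal.ofReal_le_ofReal (le_of_tendsto (hL φ) (Eventually.of_forall fun t => ?_))
    refine (le_abs_self _).trans ((hbound φ 1 zero_le_one (fun x => ?_) t).trans_eq (one_mul _))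
    change ‖g x‖ ≤ 1
    rw [Real.norm_of_nonneg (hg01 x).1]
    exact (hg01 x).2
  · rw [RealRMK.integral_rieszMeasure]
    exact hL φ

end VagueCompactness

/-! ### Existence of the distributional gradient. -/

variable {d : ℕ} {f : EuclideanSpace ℝ (Fin d) → ℝ}

/-- The field −φ eᵢ is admissible in the supremum and has divergence −∂ᵢφ. -/
theorem IsBV.neg_integral_mul_fderiv_single_le (hf : IsBV f) (i : Fin d)
    {φ : EuclideanSpace ℝ (Fin d) → ℝ} (hφ : IsTest φ) :
    -∫ x, f x * fderiv ℝ φ x (EuclideanSpace.single i 1) ≤ (totalVariation f).toReal := by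
  set e : EuclideanSpace ℝ (Fin d) := EuclideanSpace.single i 1 with he
  set v : EuclideanSpace ℝ (Fin d) → EuclideanSpace ℝ (Fin d) := fun x => (-φ x) • e with hv
  have hdiv : ∀ x, divergence v x = -fderiv ℝ φ x e := by
    intro x
    have h1 : fderiv ℝ v x = (fderiv ℝ (fun x => -φ x) x).smulRight e :=
      fderiv_smul_const (hφ.differentiable.neg x) e
    simp only [divergence, h1, fderiv_fun_neg]
    rw [Finset.sum_eq_single i]
    · simp [he]
    · intro j _ hj
      simp [he, hj]
    · simp
  have hle : ENNReal.ofReal (∫ x, f x * divergence v x) ≤ totalVariation f := by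
    refine le_iSup₂_of_le v ⟨hφ.contDiff.neg.smul contDiff_const,
      hφ.neg.hasCompactSupport.smul_right, fun x => ?_⟩ le_rfl
    rw [hv]
    simp only [norm_smul, he]
    simpa using hφ.abs_le x
  have := ENNReal.ofReal_le_iff_le_toReal hf.2.ne |>.1 hle
  simpa [hdiv, integral_neg] using this

/-- P and N are vague limits of the positive and negative parts of the difference quotients g n,
taken as densities; the L¹ bound on g n controls both masses. -/
theorem IsBV.exists_measures_partialDeriv (hf : IsBV f) (i : Fin d) :
    ∃ P N : Measure (EuclideanSpace ℝ (Fin d)), IsFiniteMeasure P ∧ IsFiniteMeasure N ∧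
      ∀ φ : EuclideanSpace ℝ (Fin d) → ℝ, IsTest φ →
        ∫ x, f x * fderiv ℝ φ x (EuclideanSpace.single i 1) =
          -(∫ x, φ x ∂P - ∫ x, φ x ∂N) := by
  set e : EuclideanSpace ℝ (Fin d) := EuclideanSpace.single i 1 with he
  set M := (totalVariation f).toReal with hM
  set t : ℕ → ℝ := fun n => 1 / ((n : ℝ) + 1) with ht
  have ht0 : ∀ n, 0 < t n := fun n => Nat.one_div_pos_of_nat
  have htlim : Tendsto t atTop (𝓝 0) := tendsto_one_div_add_atTop_nhds_zero_nat
  -- The ultrafilter replaces extraction of subsequences; the ordinary limit of ∫ g n φ is also a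
  -- limit along it, so the two can be identified.
  have hU : (hyperfilter ℕ : Filter ℕ) ≤ atTop := Nat.hyperfilter_le_atTop
  set g : ℕ → EuclideanSpace ℝ (Fin d) → ℝ := fun n x => (t n)⁻¹ * (f (x + t n • e) - f x) with hg
  have hgint : ∀ n, Integrable (g n) := fun n =>
    ((hf.1.comp_add_right (t n • e)).sub hf.1).const_mul _
  have hgM : ∀ n, ∫⁻ x, ‖g n x‖ₑ ≤ ENNReal.ofReal M := by
    intro n
    have h1 : ∫ x, |f (x + t n • e) - f x| ≤ t n * M := by
      refine integral_abs_sub_le hf.1 (t n • e) fun φ hφ => ?_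
      have := mul_le_mul_of_nonneg_left (hf.neg_integral_mul_fderiv_single_le i hφ) (ht0 n).le
      rw [mul_neg, ← integral_const_mul] at this
      refine le_trans (le_of_eq ?_) this
      congr 2
      ext x
      simp; ring
    rw [← ofReal_integral_norm_eq_lintegral_enorm (hgint n)]
    refine ENNReal.ofReal_le_ofReal ?_
    simp only [hg, norm_mul, norm_inv, Real.norm_eq_abs, abs_of_pos (ht0 n)]
    rw [integral_const_mul, inv_mul_le_iff₀ (ht0 n)]
    exact h1
  have key : ∀ h : ℕ → EuclideanSpace ℝ (Fin d) → ℝ, (∀ n x, 0 ≤ h n x) →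
      (∀ n x, h n x ≤ |g n x|) → (∀ n, AEMeasurable (h n)) →
      ∃ P : Measure (EuclideanSpace ℝ (Fin d)), IsFiniteMeasure P ∧
      ∀ φ : EuclideanSpace ℝ (Fin d) → ℝ, IsTest φ →
        Tendsto (fun n => ∫ x, h n x * φ x) (hyperfilter ℕ) (𝓝 (∫ x, φ x ∂P)) := by
    intro h h0 hle hmeas
    obtain ⟨P, hP, hPt⟩ := exists_tendsto_integral_ultrafilter (hyperfilter ℕ)
      (fun n => volume.withDensity fun x => ENNReal.ofReal (h n x)) M.toNNReal (fun n => by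
        rw [withDensity_apply _ MeasurableSet.univ, Measure.restrict_univ]
        refine le_trans (lintegral_mono fun x => ?_) (hgM n)
        rw [Real.enorm_eq_ofReal_abs]
        exact ENNReal.ofReal_le_ofReal (hle n x))
    refine ⟨P, hP, fun φ hφ => ?_⟩
    refine (hPt ⟨⟨φ, hφ.contDiff.continuous⟩, hφ.hasCompactSupport⟩).congr fun n => ?_
    rw [integral_withDensity_eq_integral_toReal_smul₀ (hmeas n).ennreal_ofReal
      (Eventually.of_forall fun x => ENNReal.ofReal_lt_top)]
    refine integral_congr_ae (Eventually.of_forall fun x => ?_)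
    simp [ENNReal.toReal_ofReal (h0 n x)]
  obtain ⟨P, hP, hPt⟩ := key (fun n x => max (g n x) 0) (fun n x => le_max_right _ _)
    (fun n x => max_le (le_abs_self _) (abs_nonneg _))
    (fun n => (hgint n).aemeasurable.max aemeasurable_const)
  obtain ⟨N, hN, hNt⟩ := key (fun n x => max (-g n x) 0) (fun n x => le_max_right _ _)
    (fun n x => max_le (neg_le_abs _) (abs_nonneg _))
    (fun n => (hgint n).aemeasurable.neg.max aemeasurable_const)
  refine ⟨P, N, hP, hN, fun φ hφ => ?_⟩
  have hb : ∀ {u : EuclideanSpace ℝ (Fin d) → ℝ}, Integrable u →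
      Integrable (fun x => u x * φ x) := fun hu =>
    hu.mul_bdd (c := 1) hφ.contDiff.continuous.aestronglyMeasurable
      (Eventually.of_forall hφ.abs_le)
  have h1 : Tendsto (fun n => ∫ x, g n x * φ x) (hyperfilter ℕ)
      (𝓝 (∫ x, φ x ∂P - ∫ x, φ x ∂N)) := by
    refine ((hPt φ hφ).sub (hNt φ hφ)).congr fun n => ?_
    rw [← integral_sub (hb (hgint n).pos_part) (hb (u := fun x => max (-g n x) 0)
      (hgint n).neg.pos_part)]
    refine integral_congr_ae (Eventually.of_forall fun x => ?_)
    simp only [← sub_mul]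
    congr 1
    rcases le_total 0 (g n x) with h | h <;> simp [h]
  obtain ⟨C, hC0, hC⟩ := exists_abs_integral_sub_mul_add_le hf.1 hφ
  have h2 : Tendsto (fun n => ∫ x, g n x * φ x) atTop (𝓝 (-∫ x, f x * fderiv ℝ φ x e)) := by
    rw [tendsto_iff_dist_tendsto_zero]
    have hlim : Tendsto (fun n => C * t n) atTop (𝓝 0) := by simpa using htlim.const_mul C
    refine squeeze_zero (fun _ => dist_nonneg) (fun n => ?_) hlim
    have := hC (t n • e)
    have he1 : ‖t n • e‖ = t n := by
      rw [norm_smul, he]; simp [abs_of_pos (ht0 n)]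
    have e1 : ∫ x, (f (x + t n • e) - f x) * φ x = t n * ∫ x, g n x * φ x := by
      rw [← integral_const_mul]
      congr 1; ext x
      have := (ht0 n).ne'
      simp only [hg]; field_simp
    have e2 : ∫ x, f x * fderiv ℝ φ x (t n • e) = t n * ∫ x, f x * fderiv ℝ φ x e := by
      rw [← integral_const_mul]
      congr 1; ext x
      simp; ring
    rw [he1, e1, e2, ← mul_add, abs_mul, abs_of_pos (ht0 n)] at this
    rw [Real.dist_eq, sub_neg_eq_add]
    have ht := ht0 n
    refine le_of_mul_le_mul_left (this.trans_eq ?_) ht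
    ring
  have := tendsto_nhds_unique h1 (h2.mono_left hU)
  linarith

theorem exists_isTest_smul {φ : EuclideanSpace ℝ (Fin d) → ℝ} (hφ : ContDiff ℝ ∞ φ)
    (hc : HasCompactSupport φ) : ∃ (c : ℝ) (ψ : EuclideanSpace ℝ (Fin d) → ℝ),
      IsTest ψ ∧ φ = fun x => c * ψ x := by
  obtain ⟨C, hC⟩ := hc.exists_bound_of_continuous hφ.continuous
  have h0 : (0 : ℝ) < max C 1 := lt_max_of_lt_right one_pos
  refine ⟨max C 1, fun x => (max C 1)⁻¹ * φ x, ⟨contDiff_const.mul hφ, hc.mul_left, fun x => ?_⟩,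
    ?_⟩
  · rw [abs_mul, abs_inv, abs_of_pos h0, inv_mul_le_iff₀ h0, mul_one]
    exact (hC x).trans (le_max_left _ _)
  · ext x
    field_simp

theorem integrable_smul_gradient (hf : Integrable f) {φ : EuclideanSpace ℝ (Fin d) → ℝ}
    (hφ : ContDiff ℝ ∞ φ) (hc : HasCompactSupport φ) : Integrable (fun x => f x • ∇ φ x) := by
  have hcont : Continuous (∇ φ) :=
    (LinearIsometryEquiv.continuous _).comp (hφ.continuous_fderiv (by simp))
  obtain ⟨C, hC⟩ := (hc.fderiv ℝ).exists_bound_of_continuous (hφ.continuous_fderiv (by simp))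
  refine hf.smul_bdd C hcont.aestronglyMeasurable (Eventually.of_forall fun x => ?_)
  rw [gradient, LinearIsometryEquiv.norm_map]
  exact hC x

/-- Every function of bounded variation has a distributional gradient. -/
theorem IsBV.exists_isDistribGradient (hf : IsBV f) : ∃ D, IsDistribGradient f D := by
  choose P N hP hN hPN using hf.exists_measures_partialDeriv
  let e : Fin d → EuclideanSpace ℝ (Fin d) := fun i => EuclideanSpace.single i 1
  let T : Fin d → ℝ →L[ℝ] EuclideanSpace ℝ (Fin d) := fun i =>
    (ContinuousLinearMap.id ℝ ℝ).smulRight (e i)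
  let s : Fin d → SignedMeasure (EuclideanSpace ℝ (Fin d)) := fun i =>
    (P i).toSignedMeasure - (N i).toSignedMeasure
  have hs : ∀ i, IsFiniteMeasure (s i).variation := fun i =>
    isFiniteMeasure_of_le (P i + N i) (VectorMeasure.variation_sub_le (μ := (P i).toSignedMeasure)
      (ν := (N i).toSignedMeasure) |>.trans_eq (by simp))
  -- Df is assembled as Σ (Pᵢ − Nᵢ) eᵢ, and the defining identity is checked coordinate by
  -- coordinate.
  let D := ∑ i, (s i).mapRange (T i : ℝ →+ EuclideanSpace ℝ (Fin d)) (T i).continuous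
  have hD : IsFiniteMeasure D.variation := isFiniteMeasure_of_le _
    (VectorMeasure.variation_finsetSum_le Finset.univ _)
  refine ⟨D, hD, fun φ hφ hc => ?_⟩
  have hφint : ∀ (ν : Measure (EuclideanSpace ℝ (Fin d))) [IsFiniteMeasure ν],
      Integrable φ ν := fun ν _ =>
    hφ.continuous.integrable_of_hasCompactSupport hc
  obtain ⟨c, ψ, hψ, rfl⟩ := exists_isTest_smul hφ hc
  have h1 : ∀ i, ∫ x, f x * fderiv ℝ (fun x => c * ψ x) x (e i) =
      -(∫ x, c * ψ x ∂P i - ∫ x, c * ψ x ∂N i) := by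
    intro i
    have hfd : ∀ x, fderiv ℝ (fun x => c * ψ x) x = c • fderiv ℝ ψ x := fun x =>
      fderiv_const_mul (hψ.differentiable x) c
    simp only [hfd, integral_const_mul]
    have := hPN i ψ hψ
    calc _ = c * ∫ x, f x * fderiv ℝ ψ x (e i) := by
          rw [← integral_const_mul]; congr 1; ext x; simp; ring
      _ = _ := by rw [this]; ring
  rw [VectorMeasure.integral_finsetSum_vectorMeasure (fun i _ => hφint _)]
  have h2 : ∀ i, ∫ᵛ x, c * ψ x ∂•((s i).mapRange (T i : ℝ →+ EuclideanSpace ℝ (Fin d))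
      (T i).continuous) = (∫ x, c * ψ x ∂P i - ∫ x, c * ψ x ∂N i) • e i := by
    intro i
    rw [integral_mapRange _ _ (hφint _), VectorMeasure.integral_sub_vectorMeasure,
      integral_toSignedMeasure', integral_toSignedMeasure']
    · simp [T]
    · simpa [VectorMeasure.Integrable] using hφint (P i)
    · simpa [VectorMeasure.Integrable] using hφint (N i)
  simp_rw [h2]
  have hgi := integrable_smul_gradient hf.1 hφ hc
  refine ext_inner_left ℝ fun y => ?_
  have hy : y = ∑ i, y i • e i := by
    have := (EuclideanSpace.basisFun (Fin d) ℝ).sum_repr y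
    simpa [e] using this.symm
  suffices h : ∀ i, inner ℝ (e i) (∫ x, f x • ∇ (fun x => c * ψ x) x) =
      inner ℝ (e i) (-∑ i, (∫ x, c * ψ x ∂P i - ∫ x, c * ψ x ∂N i) • e i) by
    rw [hy, sum_inner, sum_inner]
    simp only [inner_smul_left, h]
  intro i
  rw [← integral_inner hgi, inner_neg_right, inner_sum]
  simp only [inner_smul_right]
  rw [Finset.sum_eq_single i]
  · have h3 : ∀ x, inner ℝ (e i) (∇ (fun x => c * ψ x) x) =
        fderiv ℝ (fun x => c * ψ x) x (e i) := fun x => by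
      rw [real_inner_comm]; simp
    simp only [h3, h1]
    simp [e]
  · intro j _ hj
    simp [e, EuclideanSpace.inner_single_left, hj.symm]
  · simp

/-! ### The directional variation V and its two-sided comparison with increments. -/

section DirectionalVariation

variable {d : ℕ} {f : EuclideanSpace ℝ (Fin d) → ℝ}
  {D : VectorMeasure (EuclideanSpace ℝ (Fin d)) (EuclideanSpace ℝ (Fin d))}

/-- The total mass of `|D · y|`. -/
def directionalVariation
    (D : VectorMeasure (EuclideanSpace ℝ (Fin d)) (EuclideanSpace ℝ (Fin d)))
    (y : EuclideanSpace ℝ (Fin d)) : ℝ :=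
  (dotMeasure D y).variation.real univ

theorem isFiniteMeasure_variation_dotMeasure [IsFiniteMeasure D.variation]
    (y : EuclideanSpace ℝ (Fin d)) : IsFiniteMeasure (dotMeasure D y).variation :=
  isFiniteMeasure_variation_mapRange D (innerSL ℝ y)

theorem dotMeasure_apply (y : EuclideanSpace ℝ (Fin d)) (s : Set (EuclideanSpace ℝ (Fin d))) :
    dotMeasure D y s = inner ℝ y (D s) := rfl

theorem directionalVariation_nonneg (y : EuclideanSpace ℝ (Fin d)) :
    0 ≤ directionalVariation D y := measureReal_nonneg

theorem ofReal_directionalVariation [IsFiniteMeasure D.variation]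
    (y : EuclideanSpace ℝ (Fin d)) :
    ENNReal.ofReal (directionalVariation D y) = (dotMeasure D y).variation univ := by
  have := isFiniteMeasure_variation_dotMeasure (D := D) y
  simp [directionalVariation]

theorem directionalVariation_smul {r : ℝ} (hr : 0 ≤ r) (y : EuclideanSpace ℝ (Fin d)) :
    directionalVariation D (r • y) = r * directionalVariation D y := by
  have h : dotMeasure D (r • y) = r • dotMeasure D y := by
    ext s _
    simp [dotMeasure_apply, inner_smul_left]
  simp [directionalVariation, h, VectorMeasure.variation_smul, measureReal_def, abs_of_nonneg hr]

theorem directionalVariation_le [IsFiniteMeasure D.variation] (y : EuclideanSpace ℝ (Fin d)) :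
    directionalVariation D y ≤ ‖y‖ * D.variation.real univ := by
  have h := variation_mapRange_le D (innerSL ℝ y) univ
  refine (ENNReal.toReal_mono ?_ h).trans_eq ?_
  · simpa using ENNReal.mul_ne_top ENNReal.coe_ne_top (measure_ne_top _ _)
  · have : ‖innerSL ℝ y‖₊ = ‖y‖₊ := by ext; simp
    rw [this]
    simp [measureReal_def]

theorem directionalVariation_le_add [IsFiniteMeasure D.variation]
    (y z : EuclideanSpace ℝ (Fin d)) :
    directionalVariation D y ≤ directionalVariation D z + directionalVariation D (y - z) := by
  have h : dotMeasure D y = dotMeasure D z + dotMeasure D (y - z) := by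
    ext s _
    simp [dotMeasure_apply, inner_sub_left]
  have := isFiniteMeasure_variation_dotMeasure (D := D) z
  have := isFiniteMeasure_variation_dotMeasure (D := D) (y - z)
  have hle := VectorMeasure.variation_add_le (μ := dotMeasure D z) (ν := dotMeasure D (y - z)) univ
  rw [← h] at hle
  rw [directionalVariation, directionalVariation, directionalVariation, ← measureReal_add_apply]
  exact ENNReal.toReal_mono (measure_ne_top _ _) hle

/-- Subadditivity and V(y) ≤ |y| |D|(ℝ^d) make V Lipschitz, hence an admissible integrand for weak
convergence on the sphere. -/
theorem continuous_directionalVariation [IsFiniteMeasure D.variation] :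
    Continuous (directionalVariation D) := by
  refine (LipschitzWith.of_le_add_mul (D.variation.real univ).toNNReal fun y z => ?_).continuous
  rw [Real.coe_toNNReal _ measureReal_nonneg, dist_eq_norm, mul_comm]
  exact (directionalVariation_le_add y z).trans (by gcongr; exact directionalVariation_le _)

theorem IsDistribGradient.neg_integral_mul_fderiv (hD : IsDistribGradient f D)
    (hf : Integrable f) {φ : EuclideanSpace ℝ (Fin d) → ℝ} (hφ : IsTest φ)
    (y : EuclideanSpace ℝ (Fin d)) :
    -∫ x, f x * fderiv ℝ φ x y = inner ℝ y (∫ᵛ x, φ x ∂•D) := by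
  have h1 := hD.integral_smul_gradient φ hφ.contDiff hφ.hasCompactSupport
  rw [← neg_eq_iff_eq_neg] at h1
  rw [← h1, inner_neg_right,
    ← integral_inner (integrable_smul_gradient hf hφ.contDiff hφ.hasCompactSupport)]
  congr 2
  ext x
  rw [inner_smul_right, real_inner_comm]
  simp

theorem integral_dotMeasure [IsFiniteMeasure D.variation] {φ : EuclideanSpace ℝ (Fin d) → ℝ}
    (hφ : IsTest φ) (y : EuclideanSpace ℝ (Fin d)) :
    ∫ᵛ x, φ x ∂•(dotMeasure D y) = inner ℝ y (∫ᵛ x, φ x ∂•D) :=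
  integral_mapRange D (innerSL ℝ y) (hφ.integrable _)

/-- Tested against φ, the weak derivative along y is ∫ φ d(D·y), at most V(y) because |φ| ≤ 1. No
smallness of y is needed. -/
theorem IsDistribGradient.integral_abs_sub_le (hD : IsDistribGradient f D)
    (hf : Integrable f) (y : EuclideanSpace ℝ (Fin d)) :
    ∫ x, |f (x + y) - f x| ≤ directionalVariation D y := by
  have := hD.finite_variation
  refine NonlocalPerimeter.integral_abs_sub_le hf y fun φ hφ => ?_
  rw [hD.neg_integral_mul_fderiv hf hφ, ← integral_dotMeasure hφ]
  have := isFiniteMeasure_variation_dotMeasure (D := D) y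
  refine (Real.le_norm_self _).trans ((VectorMeasure.norm_integral_le_of_norm_le_const (C := 1)
    (Eventually.of_forall hφ.abs_le)).trans ?_)
  rw [directionalVariation, one_mul]
  exact mul_le_of_le_one_left measureReal_nonneg (ContinuousLinearMap.opNorm_lsmul_le)

theorem exists_isTest_directionalVariation_lt [IsFiniteMeasure D.variation]
    (y : EuclideanSpace ℝ (Fin d)) {η : ℝ} (hη : 0 < η) :
    ∃ φ, IsTest φ ∧ directionalVariation D y < inner ℝ y (∫ᵛ x, φ x ∂•D) + η := by
  by_contra! hcon
  have h1 : ∀ φ : EuclideanSpace ℝ (Fin d) → ℝ, IsTest φ →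
      ∫ᵛ x, φ x ∂•(dotMeasure D y) ≤ directionalVariation D y - η := fun φ hφ => by
    rw [integral_dotMeasure hφ]
    linarith [hcon φ hφ]
  -- Taking φ = 0 rules out a negative bound, which `ENNReal.ofReal` would truncate to 0.
  have h0 : 0 ≤ directionalVariation D y - η := by
    simpa using h1 (fun _ => 0) ⟨contDiff_const, HasCompactSupport.zero, by simp⟩
  have h2 := variation_univ_le_of_forall_isTest _ h1
  rw [← ofReal_directionalVariation, ENNReal.ofReal_le_ofReal_iff h0] at h2
  linarith

/-- The `L¹` difference quotients are asymptotically at least the directional variation,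
uniformly in the direction. -/
theorem IsDistribGradient.exists_directionalVariation_le (hD : IsDistribGradient f D)
    (hf : Integrable f) {η : ℝ} (hη : 0 < η) :
    ∃ R : ℝ, 0 < R ∧ ∀ θ ∈ sphere (0 : EuclideanSpace ℝ (Fin d)) 1, ∀ r : ℝ, 0 < r → r ≤ R →
      directionalVariation D θ ≤ (∫ x, |f (x + r • θ) - f x|) / r + η := by
  have := hD.finite_variation
  have hev : ∀ᶠ r : ℝ in 𝓝 0, ∀ θ ∈ sphere (0 : EuclideanSpace ℝ (Fin d)) 1,
      0 < r → directionalVariation D θ ≤ (∫ x, |f (x + r • θ) - f x|) / r + η := by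
    refine (isCompact_sphere _ _).eventually_forall_of_forall_eventually fun θ₀ _ => ?_
    obtain ⟨φ, hφ, hφη⟩ := exists_isTest_directionalVariation_lt (D := D) θ₀ hη
    obtain ⟨C, hC0, hC⟩ := exists_abs_integral_sub_mul_add_le hf hφ
    set w := ∫ᵛ x, φ x ∂•D
    -- The last term is the Taylor error divided by r. At (0, θ₀) the expression is below η by the
    -- choice of φ, so it stays below η for (r, θ) nearby.
    have hcont : Continuous fun z : ℝ × EuclideanSpace ℝ (Fin d) =>
        directionalVariation D z.2 - inner ℝ z.2 w + C * (z.1 * ‖z.2‖ ^ 2) := by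
      have := continuous_directionalVariation (D := D)
      fun_prop
    have hlt := (hcont.tendsto (0, θ₀)).eventually_lt_const (u := η) (by simp; linarith)
    filter_upwards [hlt] with z hz hr
    obtain ⟨r, θ⟩ := z
    simp only at hz hr ⊢
    have h1 := (abs_le.1 (hC (r • θ))).1
    have h2 := hD.neg_integral_mul_fderiv hf hφ (r • θ)
    rw [inner_smul_left] at h2
    simp only [conj_trivial] at h2
    have hi : Integrable fun x => f (x + r • θ) - f x := (hf.comp_add_right _).sub hf
    have h3 : ∫ x, (f (x + r • θ) - f x) * φ x ≤ ∫ x, |f (x + r • θ) - f x| := by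
      refine integral_mono (hi.mul_bdd (c := 1) hφ.contDiff.continuous.aestronglyMeasurable
        (Eventually.of_forall hφ.abs_le)) hi.abs fun x => ?_
      refine (le_abs_self _).trans ?_
      rw [abs_mul]
      exact mul_le_of_le_one_right (abs_nonneg _) (hφ.abs_le x)
    rw [norm_smul, Real.norm_of_nonneg hr.le] at h1
    have h4 : inner ℝ θ w - C * (r * ‖θ‖ ^ 2) ≤ (∫ x, |f (x + r • θ) - f x|) / r := by
      rw [le_div_iff₀ hr]
      calc _ = r * inner ℝ θ w - C * (r * ‖θ‖) ^ 2 := by ring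
        _ ≤ _ := by linarith
    linarith
  obtain ⟨R, hR, hRb⟩ := Metric.eventually_nhds_iff.1 hev
  refine ⟨R / 2, by positivity, fun θ hθ r hr hrR => hRb ?_ θ hθ hr⟩
  rw [dist_zero_right, Real.norm_of_nonneg hr.le]
  linarith

end DirectionalVariation

/-! ### Integrals over the projected measure. -/

section SphericalProjection

variable {d : ℕ} {ν : Measure (EuclideanSpace ℝ (Fin d))}

theorem lintegral_sphericalProjection (hν : ν {0} = 0)
    {F : EuclideanSpace ℝ (Fin d) → ENNReal} (hF : Measurable F) :
    ∫⁻ θ, F θ ∂sphericalProjection ν = ∫⁻ y, F (‖y‖⁻¹ • y) ∂ν := by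
  have hm : Measurable (fun y : ({0}ᶜ : Set (EuclideanSpace ℝ (Fin d))) =>
      (homeomorphUnitSphereProd (EuclideanSpace ℝ (Fin d)) y).1) := by
    fun_prop
  rw [sphericalProjection, lintegral_map
    (f := fun θ : sphere (0 : EuclideanSpace ℝ (Fin d)) 1 => F θ) (hF.comp measurable_subtype_coe) hm]
  simp only [homeomorphUnitSphereProd_apply_fst_coe]
  rw [lintegral_subtype_comap (measurableSet_singleton _).compl fun y => F (‖y‖⁻¹ • y),
    Measure.restrict_eq_self_of_ae_mem (s := {0}ᶜ) (compl_mem_ae_iff.2 hν)]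

theorem isProbabilityMeasure_sphericalProjection [IsProbabilityMeasure ν] (hν : ν {0} = 0) :
    IsProbabilityMeasure (sphericalProjection ν) := by
  refine ⟨?_⟩
  have := lintegral_sphericalProjection hν (F := fun _ => 1) measurable_const
  simpa using this

end SphericalProjection

/-! ### Comparison of the energy with the spherical average of V, and the limit. -/

section NonlocalEnergy

variable {d : ℕ} {f : EuclideanSpace ℝ (Fin d) → ℝ}
  {D : VectorMeasure (EuclideanSpace ℝ (Fin d)) (EuclideanSpace ℝ (Fin d))}
  {ν : Measure (EuclideanSpace ℝ (Fin d))}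

theorem lintegral_ofReal_abs_sub_div (hf : Integrable f) (y : EuclideanSpace ℝ (Fin d)) :
    ∫⁻ x, ENNReal.ofReal (|f (x + y) - f x| / ‖y‖) =
      ENNReal.ofReal ((∫ x, |f (x + y) - f x|) / ‖y‖) := by
  have hi : Integrable fun x => |f (x + y) - f x| / ‖y‖ :=
    ((hf.comp_add_right _).sub hf).abs.div_const _
  rw [← ofReal_integral_eq_lintegral_ofReal hi (Eventually.of_forall fun x => by positivity),
    integral_div]

theorem lintegral_lintegral_abs_sub_div [SFinite ν] (hf : Integrable f) :
    ∫⁻ x, ∫⁻ y, ENNReal.ofReal (|f (x + y) - f x| / ‖y‖) ∂ν =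
      ∫⁻ y, ENNReal.ofReal ((∫ x, |f (x + y) - f x|) / ‖y‖) ∂ν := by
  rw [lintegral_lintegral_swap]
  · simp_rw [lintegral_ofReal_abs_sub_div hf]
  · have h1 : AEMeasurable (fun p : EuclideanSpace ℝ (Fin d) × EuclideanSpace ℝ (Fin d) =>
        f (p.1 + p.2)) (volume.prod ν) :=
      (hf.aemeasurable.comp_fst (ν := ν)).comp_quasiMeasurePreserving
        (measurePreserving_add_prod volume ν).quasiMeasurePreserving
    have h2 : AEMeasurable (fun p : EuclideanSpace ℝ (Fin d) × EuclideanSpace ℝ (Fin d) =>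
        f p.1) (volume.prod ν) := hf.aemeasurable.comp_fst
    exact (((h1.sub h2).abs).div (measurable_snd.norm.aemeasurable)).ennreal_ofReal

/-- After Tonelli the bound is pointwise in y: the increment is at most V(y), and V(y)/|y| =
V(y/|y|) by homogeneity. -/
theorem IsDistribGradient.energy_le (hD : IsDistribGradient f D) (hf : Integrable f)
    [SFinite ν] (hν : ν {0} = 0) :
    ∫⁻ x, ∫⁻ y, ENNReal.ofReal (|f (x + y) - f x| / ‖y‖) ∂ν ≤
      ∫⁻ θ, (dotMeasure D θ).variation univ ∂sphericalProjection ν := by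
  have := hD.finite_variation
  simp_rw [← ofReal_directionalVariation]
  rw [lintegral_lintegral_abs_sub_div hf, lintegral_sphericalProjection hν
    (F := fun y => ENNReal.ofReal (directionalVariation D y))
    continuous_directionalVariation.measurable.ennreal_ofReal]
  refine lintegral_mono fun y => ENNReal.ofReal_le_ofReal ?_
  rw [directionalVariation_smul (by positivity), inv_mul_eq_div]
  gcongr
  exact hD.integral_abs_sub_le hf y

/-- R is chosen before ν. Inside the ball the uniform lower bound costs η; outside, the crude bound
V ≤ |D|(ℝ^d) on unit vectors suffices. -/
theorem IsDistribGradient.exists_le_energy (hD : IsDistribGradient f D) (hf : Integrable f)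
    {η : ℝ} (hη : 0 < η) : ∃ R : ℝ, 0 < R ∧
      ∀ (ν : Measure (EuclideanSpace ℝ (Fin d))) [IsProbabilityMeasure ν], ν {0} = 0 →
      ∫⁻ θ, (dotMeasure D θ).variation univ ∂sphericalProjection ν ≤
        (∫⁻ x, ∫⁻ y, ENNReal.ofReal (|f (x + y) - f x| / ‖y‖) ∂ν) +
          (ENNReal.ofReal η + D.variation univ * ν (closedBall 0 R)ᶜ) := by
  have := hD.finite_variation
  obtain ⟨R, hR, hRb⟩ := hD.exists_directionalVariation_le hf hη
  refine ⟨R, hR, fun ν _ hν => ?_⟩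
  simp_rw [← ofReal_directionalVariation]
  rw [lintegral_lintegral_abs_sub_div hf, lintegral_sphericalProjection hν
    (F := fun y => ENNReal.ofReal (directionalVariation D y))
    continuous_directionalVariation.measurable.ennreal_ofReal]
  set K := D.variation univ with hK
  have hmeas : MeasurableSet (closedBall (0 : EuclideanSpace ℝ (Fin d)) R)ᶜ :=
    measurableSet_closedBall.compl
  have hpt : ∀ᵐ y ∂ν, ENNReal.ofReal (directionalVariation D (‖y‖⁻¹ • y)) ≤
      ENNReal.ofReal ((∫ x, |f (x + y) - f x|) / ‖y‖) +
        (ENNReal.ofReal η + (closedBall (0 : EuclideanSpace ℝ (Fin d)) R)ᶜ.indicator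
          (fun _ => K) y) := by
    filter_upwards [compl_mem_ae_iff.2 hν] with y hy
    have hy0 : 0 < ‖y‖ := norm_pos_iff.2 hy
    by_cases hyR : y ∈ closedBall (0 : EuclideanSpace ℝ (Fin d)) R
    · have h1 := hRb (‖y‖⁻¹ • y) (by simp [norm_smul, hy0.ne']) ‖y‖ hy0 (by simpa using hyR)
      rw [smul_smul, mul_inv_cancel₀ hy0.ne', one_smul] at h1
      refine (ENNReal.ofReal_le_ofReal h1).trans ?_
      rw [ENNReal.ofReal_add (by positivity) hη.le]
      gcongr
      exact le_self_add
    · have h1 := directionalVariation_le (D := D) (‖y‖⁻¹ • y)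
      rw [norm_smul, norm_inv, norm_norm, inv_mul_cancel₀ hy0.ne', one_mul] at h1
      rw [indicator_of_mem (show y ∈ (closedBall 0 R)ᶜ from hyR)]
      rw [hK, ← ofReal_measureReal]
      exact (ENNReal.ofReal_le_ofReal h1).trans (le_add_self.trans le_add_self)
  refine (lintegral_mono_ae hpt).trans_eq ?_
  rw [lintegral_add_right _ ((measurable_const.indicator hmeas).const_add _),
    lintegral_add_right _ (measurable_const.indicator hmeas), lintegral_indicator_const hmeas]
  simp

theorem IsDistribGradient.tendsto_energy (hD : IsDistribGradient f D) (hf : Integrable f)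
    {ν : ℕ → Measure (EuclideanSpace ℝ (Fin d))} [∀ j, IsProbabilityMeasure (ν j)]
    (hzero : ∀ j, ν j {0} = 0)
    (hconc : ∀ R : ℝ, 0 < R → Tendsto (fun j => ν j (closedBall 0 R)ᶜ) atTop (𝓝 0))
    {μ : Measure (sphere (0 : EuclideanSpace ℝ (Fin d)) 1)} [IsProbabilityMeasure μ]
    (hμ : ∀ F : C(sphere (0 : EuclideanSpace ℝ (Fin d)) 1, ℝ),
      Tendsto (fun j => ∫ θ, F θ ∂sphericalProjection (ν j)) atTop (𝓝 (∫ θ, F θ ∂μ))) :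
    Tendsto (fun j => ∫⁻ x, ∫⁻ y, ENNReal.ofReal (|f (x + y) - f x| / ‖y‖) ∂ν j) atTop
      (𝓝 (∫⁻ θ, (dotMeasure D θ).variation univ ∂μ)) := by
  have := hD.finite_variation
  have hprob : ∀ j, IsProbabilityMeasure (sphericalProjection (ν j)) := fun j =>
    isProbabilityMeasure_sphericalProjection (hzero j)
  let V : C(sphere (0 : EuclideanSpace ℝ (Fin d)) 1, ℝ) :=
    ⟨fun θ => directionalVariation D θ,
      continuous_directionalVariation.comp continuous_subtype_val⟩
  have hV : ∀ (ρ : Measure (sphere (0 : EuclideanSpace ℝ (Fin d)) 1)) [IsProbabilityMeasure ρ],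
      ∫⁻ θ, (dotMeasure D θ).variation univ ∂ρ = ENNReal.ofReal (∫ θ, V θ ∂ρ) := by
    intro ρ _
    simp_rw [← ofReal_directionalVariation]
    exact (ofReal_integral_eq_lintegral_ofReal
      (V.continuous.integrable_of_hasCompactSupport (HasCompactSupport.of_compactSpace _))
      (Eventually.of_forall fun θ => directionalVariation_nonneg _)).symm
  have hA : Tendsto (fun j => ∫⁻ θ, (dotMeasure D θ).variation univ ∂sphericalProjection (ν j))
      atTop (𝓝 (∫⁻ θ, (dotMeasure D θ).variation univ ∂μ)) := by
    simp_rw [hV]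
    exact ENNReal.tendsto_ofReal (hμ V)
  set I := fun j => ∫⁻ x, ∫⁻ y, ENNReal.ofReal (|f (x + y) - f x| / ‖y‖) ∂ν j
  set A := fun j => ∫⁻ θ, (dotMeasure D θ).variation univ ∂sphericalProjection (ν j)
  have hIA : ∀ j, I j ≤ A j := fun j => hD.energy_le hf (hzero j)
  have hAtop : ∀ j, A j ≠ ⊤ := fun j => by
    simp only [A, hV]; exact ENNReal.ofReal_ne_top
  have herr : Tendsto (fun j => A j - I j) atTop (𝓝 0) := by
    rw [ENNReal.tendsto_nhds_zero]
    intro ε hε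
    obtain ⟨δ, hδ0, hδε⟩ := ENNReal.lt_iff_exists_nnreal_btwn.1 hε
    have hδ : (0 : ℝ) < δ := by exact_mod_cast hδ0
    obtain ⟨R, hR, hRb⟩ := hD.exists_le_energy hf (half_pos hδ)
    have hK : Tendsto (fun j => D.variation univ * ν j (closedBall 0 R)ᶜ)
        atTop (𝓝 0) := by
      simpa using ENNReal.Tendsto.const_mul (hconc R hR) (Or.inr (measure_ne_top D.variation univ))
    have hpos : (0 : ENNReal) < ENNReal.ofReal (δ / 2) := by simpa using hδ
    filter_upwards [ENNReal.tendsto_nhds_zero.1 hK _ hpos] with j hj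
    refine (tsub_le_iff_left.2 (hRb (ν j) (hzero j))).trans ?_
    refine (add_le_add_right hj _).trans ?_
    rw [← ENNReal.ofReal_add (by positivity) (by positivity), add_halves,
      ENNReal.ofReal_coe_nnreal]
    exact hδε.le
  -- Since I ≤ A < ∞, truncated subtraction loses nothing and I = A − (A − I).
  have hlim := ENNReal.Tendsto.sub hA herr (Or.inr ENNReal.zero_ne_top)
  rw [tsub_zero] at hlim
  exact hlim.congr fun j => ENNReal.sub_sub_cancel (hAtop j) (hIA j)

end NonlocalEnergy

end NonlocalPerimeter

end

theorem theorem3p1 {d : ℕ}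
    (lam : ℝ → Measure (EuclideanSpace ℝ (Fin d)))
    (hprob : ∀ ε, 0 < ε → IsProbabilityMeasure (lam ε))
    (hzero : ∀ ε, 0 < ε → lam ε {0} = 0)
    (hconc : ∀ R : ℝ, 0 < R →
      Tendsto (fun ε => lam ε (closedBall (0 : EuclideanSpace ℝ (Fin d)) R)ᶜ) (𝓝[>] 0) (𝓝 0)) :
    ∃ (ε : ℕ → ℝ) (μ : Measure (sphere (0 : EuclideanSpace ℝ (Fin d)) 1)),
      (∀ j, 0 < ε j) ∧ Tendsto ε atTop (𝓝 0) ∧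
      IsProbabilityMeasure μ ∧
      (∀ F : C(sphere (0 : EuclideanSpace ℝ (Fin d)) 1, ℝ),
        Tendsto (fun j => ∫ θ, F θ ∂(NonlocalPerimeter.sphericalProjection (lam (ε j))))
          atTop (𝓝 (∫ θ, F θ ∂μ))) ∧
      ∀ f : EuclideanSpace ℝ (Fin d) → ℝ, NonlocalPerimeter.IsBV f →
        (∃ D, NonlocalPerimeter.IsDistribGradient f D) ∧
        ∀ D, NonlocalPerimeter.IsDistribGradient f D →
          Tendsto
            (fun j => ∫⁻ x, ∫⁻ y, ENNReal.ofReal (|f (x + y) - f x| / ‖y‖) ∂(lam (ε j)))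
            atTop
            (𝓝 (∫⁻ θ, (NonlocalPerimeter.dotMeasure D θ).variation univ ∂μ)) := by
  have ht0 : ∀ n : ℕ, (0 : ℝ) < 1 / ((n : ℝ) + 1) := fun n => Nat.one_div_pos_of_nat
  have htlim : Tendsto (fun n : ℕ => 1 / ((n : ℝ) + 1)) atTop (𝓝 0) :=
    tendsto_one_div_add_atTop_nhds_zero_nat
  let P : ℕ → ProbabilityMeasure (sphere (0 : EuclideanSpace ℝ (Fin d)) 1) := fun n =>
    ⟨NonlocalPerimeter.sphericalProjection (lam (1 / ((n : ℝ) + 1))),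
      have := hprob _ (ht0 n)
      NonlocalPerimeter.isProbabilityMeasure_sphericalProjection (hzero _ (ht0 n))⟩
  -- Probability measures on the compact sphere are weakly sequentially compact; the subsequence is
  -- fixed before any f appears.
  obtain ⟨μ, k, hk, hμ⟩ := CompactSpace.tendsto_subseq P
  have hlim : Tendsto (fun j => 1 / ((k j : ℝ) + 1)) atTop (𝓝 0) := htlim.comp hk.tendsto_atTop
  have hlim' : Tendsto (fun j => 1 / ((k j : ℝ) + 1)) atTop (𝓝[>] 0) :=
    tendsto_nhdsWithin_iff.2 ⟨hlim, Eventually.of_forall fun j => ht0 _⟩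
  have hweak : ∀ F : C(sphere (0 : EuclideanSpace ℝ (Fin d)) 1, ℝ),
      Tendsto (fun j => ∫ θ, F θ ∂(NonlocalPerimeter.sphericalProjection
        (lam (1 / ((k j : ℝ) + 1))))) atTop (𝓝 (∫ θ, F θ ∂μ)) := fun F =>
    (ProbabilityMeasure.tendsto_iff_forall_integral_tendsto.1 hμ)
      (BoundedContinuousFunction.mkOfCompact F)
  refine ⟨fun j => 1 / ((k j : ℝ) + 1), μ, fun j => ht0 _, hlim, inferInstance, hweak,
    fun f hf => ⟨hf.exists_isDistribGradient, fun D hD => ?_⟩⟩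
  have := fun j => hprob _ (ht0 (k j))
  exact hD.tendsto_energy hf.1 (fun j => hzero _ (ht0 _)) (fun R hR => (hconc R hR).comp hlim')
    hweak
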